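/- Let $\lambda, r > 0$. Let $\Pi_0=\{X_i\}$ be a Poisson point process on $\mathbb{R}$ (dimension $d=1$) with intensity $\lambda$, and let its points move according to standard Brownian motions $(\xi_i(s))_{s\ge 0}$ on $\mathbb{R}$ started at $0$, which are independent over different $i$ and independent of $\Pi_0$, so that the $i$-th point is at $X_i+\xi_i(s)$ at time $s$. Let the isolation time of the origin be $$T_{\mathrm{isol}} = \inf\Big\{s\ge 0 : 0\notin \bigcup_i B(X_i+\xi_i(s),r)\Big\},$$ where $B(x,r)$ is the open ball of radius $r$ around $x$ and $\inf\emptyset=\infty$; thus $T_{\mathrm{isol}}$ is the first time at which all points have distance at least $r$ from the origin. Then there exist $t_0>0$ and a constant $c>0$, depending only on $\lambda$ and $r$, such that for all $t\ge t_0$ the event $\{T_{\mathrm{isol}}>t\}$ is measurable with respect to the completed probability measure and $$\mathbb{P}(T_{\mathrm{isol}}>t)\ \ge\ \exp\left(-c\,\sqrt{t}\,\log t\,\log\log t\right).$$ -/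

import Mathlib

open MeasureTheory ProbabilityTheory
open scoped NNReal ENNReal

noncomputable section

/-- The number of indices `i` with `X i ω ∈ A`: the number of nodes in `A`, with multiplicity. -/
def nodeCount {Ω : Type*} (X : ℕ → Ω → ℝ) (A : Set ℝ) (ω : Ω) : ℕ∞ :=
  {i : ℕ | X i ω ∈ A}.encard

/-- The random points `X 0, X 1, …` enumerate a homogeneous Poisson point process on `ℝ` of
intensity `lam`: the number of points in a Borel set `A` of finite Lebesgue measure is
Poisson distributed with mean `lam * volume A`, and the numbers of points in finitely many
pairwise disjoint Borel sets are independent. (For `lam > 0` such a process almost surely has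
infinitely many points, so that it can be enumerated by `ℕ`.) -/
structure IsPoissonPointProcess {Ω : Type*} [MeasurableSpace Ω]
    (lam : ℝ) (X : ℕ → Ω → ℝ) (P : Measure Ω) : Prop where
  measurable : ∀ i, Measurable (X i)
  hasLaw_nodeCount : ∀ A : Set ℝ, MeasurableSet A → volume A ≠ ∞ →
    HasLaw (nodeCount X A)
      ((poissonMeasure (lam * volume.real A).toNNReal).map (Nat.cast : ℕ → ℕ∞)) P
  iIndepFun_nodeCount : ∀ (n : ℕ) (A : Fin n → Set ℝ), (∀ j, MeasurableSet (A j)) →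
    Pairwise (Function.onFun Disjoint A) → iIndepFun (fun j ↦ nodeCount X (A j)) P

/-- Poisson Brownian motions on `ℝ` of intensity `lam`: the initial positions `X i` of the nodes
form a Poisson point process, the displacements `ξ i` are standard Brownian motions starting
at `0`, independent over different `i`, and the family of displacements is independent of the
initial positions. At time `s` node `i` is at `X i + ξ i s`. -/
structure IsPoissonBrownianMotions {Ω : Type*} [MeasurableSpace Ω]
    (lam : ℝ) (X : ℕ → Ω → ℝ) (ξ : ℕ → ℝ≥0 → Ω → ℝ) (P : Measure Ω) : Prop where
  poisson : IsPoissonPointProcess lam X P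
  brownian : ∀ i, IsBrownianReal (ξ i) P
  iIndepFun_displacement : iIndepFun (fun i ω t ↦ ξ i t ω) P
  indepFun_position_displacement : IndepFun (fun ω i ↦ X i ω) (fun ω i t ↦ ξ i t ω) P

/-- The isolation time of a target at the origin: the infimum of the times `s ≥ 0` at which the
origin is in none of the open balls of radius `r` around the nodes, that is, at which all nodes
have distance at least `r` from it; it is `∞` if there is no such time. -/
def isolationTime {Ω : Type*} (r : ℝ) (X : ℕ → Ω → ℝ) (ξ : ℕ → ℝ≥0 → Ω → ℝ) (ω : Ω) : ℝ≥0∞ :=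
  ⨅ (s : ℝ≥0) (_ : (0 : ℝ) ∉ ⋃ i, Metric.ball (X i ω + ξ i s ω) r), (s : ℝ≥0∞)

end

/-!
The origin stays covered up to time `t` if the nodes near it are atypically dense at time `0`.
Divide `[-N r / 2, N r / 2)`, where `N r / 2` is about `2 √t`, into `2 * N` cells of length `r / 2`,
and suppose that each of them holds at least `k = ⌈8 log t⌉` nodes. The cells have independent
Poisson counts, so this has probability at least `(exp (-μ) μ ^ k / k!) ^ (2 * N)` with
`μ = lam r / 2` (`le_measureReal_crowded`), which is `exp (-O(√t log t log log t))`
(`exp_neg_le_poisson`, `crowding_cost_le`). It remains to see that, given such a configuration, the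
origin is covered throughout `[0, t]` with probability at least `1 / 2`.

Split time into slots of length `δ = 1 / t`. A node covers the origin throughout a slot if it is
within `r / 2` of the origin at the start of the slot and moves by at most `r / 2` during it. Since a
cell has length `r / 2`, a node starting in it is within `r / 2` of the origin at time `s` whenever
its displacement lies in the reflected cell. Summed over the cells, the Gaussian masses of the
reflected cells give the mass of `(-N r / 2, N r / 2]`, which is at least `3 / 4` by Chebyshev's
inequality (`three_quarters_le_sum_gaussianReal_cell`); no estimate of the Gaussian density is
needed. A chaining bound along dyadic times shows that moving by more than `r / 2` within a slot has
probability `O(δ ^ 2)` (`measureReal_not_isTame_le`, `IsTame.abs_sub_le`), which remains negligible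
after summation over the `O(√t)` cells. As the displacements of different nodes are independent, no
node covers a given slot with probability at most `exp (-k / 2) ≤ t ^ (-4)`
(`IsPoissonBrownianMotions.measure_crowded_and_not_covering_le`), and a union bound over the
`O(t ^ 2)` slots concludes.

The displacements at a given time are only almost everywhere measurable, so the map to the whole
path need not be almost everywhere measurable. The events used in the estimates therefore depend on
the countably many dyadic times only, and the null-measurability of the isolation event comes from
a countable dense set of times and the continuity of the paths (`forall_le_exists_iff`).
-/

/-! ### Oscillation of a path over one time slot -/

/-- The `j`-th dyadic time of level `n` for the time unit `δ`. -/
noncomputable def dyadicTime (δ : ℝ≥0) (n j : ℕ) : ℝ≥0 := δ * j / 2 ^ n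

/-- The increment allowed across a dyadic interval of level `n + 1`. The bounds sum to `r / 2`, and
the ratio `9 / 10` exceeds `2 ^ (-1 / 4)`, so that a union bound with Gaussian fourth moments over
the `2 ^ (n + 1)` intervals of that level is summable in `n`. -/
noncomputable def stepBound (r : ℝ) (n : ℕ) : ℝ := r / 20 * (9 / 10) ^ n

/-- A family `y n j` of values at the dyadic times of level `n` is tame in the `m`-th time slot if
all its dyadic increments inside the slot obey `stepBound`. -/
def IsTame (r : ℝ) (m : ℕ) (y : ℕ → ℕ → ℝ) : Prop :=
  ∀ n, ∀ j ∈ Finset.Ico (m * 2 ^ (n + 1)) ((m + 1) * 2 ^ (n + 1)),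
    |y (n + 1) (j + 1) - y (n + 1) j| ≤ stepBound r n

lemma stepBound_nonneg {r : ℝ} (hr : 0 < r) (n : ℕ) : 0 ≤ stepBound r n := by
  unfold stepBound; positivity

lemma hasSum_stepBound (r : ℝ) : HasSum (stepBound r) (r / 2) := by
  have h := (hasSum_geometric_of_lt_one (r := (9 / 10 : ℝ)) (by norm_num) (by norm_num)).mul_left
    (r / 20)
  have h' : r / 20 * (1 - 9 / 10)⁻¹ = r / 2 := by ring
  rw [h'] at h
  exact h

/-- Chaining: a continuous path whose dyadic increments in a time slot are tame stays within
`r / 2` of its value at the start of the slot. -/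
lemma IsTame.abs_sub_le {r : ℝ} (hr : 0 < r) {δ : ℝ≥0} (hδ : 0 < δ) {f : ℝ≥0 → ℝ}
    (hf : Continuous f) {m : ℕ} (h : IsTame r m fun n j ↦ f (dyadicTime δ n j))
    {u : ℝ≥0} (hu : ⌊u / δ⌋₊ = m) : |f u - f (dyadicTime δ 0 m)| ≤ r / 2 := by
  -- `v n` is the last dyadic time of level `n` before `u`
  let a : ℕ → ℕ := fun n ↦ ⌊u / δ * 2 ^ n⌋₊
  let v : ℕ → ℝ≥0 := fun n ↦ dyadicTime δ n (a n)
  have ha0 : a 0 = m := by simp [a, hu]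
  have ha (n : ℕ) : a (n + 1) / 2 = a n := by
    simp only [a]
    rw [← Nat.floor_div_natCast]
    congr 1
    push_cast
    rw [pow_succ]
    field_simp
  have ham (n : ℕ) : m * 2 ^ n ≤ a n ∧ a n < (m + 1) * 2 ^ n := by
    induction n with
    | zero => simp [ha0]
    | succ n ih =>
      have := ha n
      rw [pow_succ]
      constructor <;> grind
  have hstep (n : ℕ) : dist (f (v n)) (f (v (n + 1))) ≤ stepBound r n := by
    have hv : v n = dyadicTime δ (n + 1) (2 * a n) := by
      simp only [v, dyadicTime]
      rw [pow_succ]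
      push_cast
      field_simp
    have h1 : a (n + 1) = 2 * a n ∨ a (n + 1) = 2 * a n + 1 := by
      have := ha n
      omega
    rw [hv]
    change dist _ (f (dyadicTime δ (n + 1) (a (n + 1)))) ≤ _
    rcases h1 with h1 | h1
    · rw [h1, dist_self]
      exact stepBound_nonneg hr n
    · rw [h1, dist_comm, Real.dist_eq]
      refine h n (2 * a n) ?_
      have := ham n
      rw [Finset.mem_Ico, pow_succ]
      constructor <;> grind
  have hlim : Filter.Tendsto v Filter.atTop (nhds u) := by
    have h2 : Filter.Tendsto (fun n : ℕ ↦ (2 : ℝ) ^ n) Filter.atTop Filter.atTop :=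
      tendsto_pow_atTop_atTop_of_one_lt (by norm_num)
    have h3 := ((tendsto_nat_floor_mul_div_atTop (R := ℝ) (a := u / δ) (by positivity)).comp
      h2).const_mul (δ : ℝ)
    rw [mul_div_cancel₀ (u : ℝ) (NNReal.coe_pos.2 hδ).ne'] at h3
    refine NNReal.tendsto_coe.1 (h3.congr fun n ↦ ?_)
    have h4 : ⌊(u / δ * 2 ^ n : ℝ)⌋₊ = a n := by
      simp only [a]
      have := Nonneg.nat_floor_coe (α := ℝ) (u / δ * 2 ^ n : ℝ≥0)
      exact_mod_cast this
    simp [v, dyadicTime, mul_div_assoc, h4]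
  have hd := dist_le_tsum_of_dist_le_of_tendsto₀ (stepBound r) hstep (hasSum_stepBound r).summable
    ((hf.tendsto u).comp hlim)
  rw [(hasSum_stepBound r).tsum_eq] at hd
  simpa only [v, ha0, Function.comp_apply, dist_comm, Real.dist_eq] using hd

lemma measurableSet_isTame (r : ℝ) (m : ℕ) : MeasurableSet {y : ℕ → ℕ → ℝ | IsTame r m y} := by
  simp only [IsTame, Set.ofPred_forall]
  refine .iInter fun n ↦ .iInter fun j ↦ .iInter fun _ ↦ measurableSet_le ?_ measurable_const
  fun_prop

/-! ### Gaussian tails -/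

lemma exp_neg_le_two_div_sq {x : ℝ} (hx : 0 < x) : Real.exp (-x) ≤ 2 / x ^ 2 := by
  have h := Real.quadratic_le_exp_of_nonneg hx.le
  rw [Real.exp_neg, inv_le_comm₀ (Real.exp_pos x) (by positivity), inv_div]
  linarith

/-- A fourth-moment type tail bound, deduced from the sub-Gaussian one. -/
lemma measureReal_lt_abs_le_of_hasLaw_gaussianReal {Ω : Type*} [MeasurableSpace Ω] {P : Measure Ω}
    [IsProbabilityMeasure P] {Z : Ω → ℝ} {v : ℝ≥0} (hv : 0 < v)
    (hZ : HasLaw Z (gaussianReal 0 v) P) {a : ℝ} (ha : 0 < a) :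
    P.real {ω | a < |Z ω|} ≤ 16 * v ^ 2 / a ^ 4 := by
  have tail {Z : Ω → ℝ} (hZ : HasLaw Z (gaussianReal 0 v) P) :
      P.real {ω | a ≤ Z ω} ≤ 8 * v ^ 2 / a ^ 4 := by
    have hsub : HasSubgaussianMGF Z v P := by
      constructor
      · intro t
        have h := integrable_exp_mul_gaussianReal (μ := 0) (v := v) t
        rw [← hZ.map_eq] at h
        exact h.comp_aemeasurable hZ.aemeasurable
      · intro t
        rw [mgf_gaussianReal hZ.map_eq]
        simp
    refine (hsub.measure_ge_le ha.le).trans ?_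
    have hv' : (0 : ℝ) < v := hv
    rw [neg_div]
    refine (exp_neg_le_two_div_sq (by positivity)).trans_eq ?_
    field_simp
    norm_num
  have hsub : {ω | a < |Z ω|} ⊆ {ω | a ≤ Z ω} ∪ {ω | a ≤ (-Z) ω} := by
    intro ω hω
    rcases lt_abs.1 hω.out with h | h
    · exact Or.inl h.le
    · exact Or.inr h.le
  have hneg : HasLaw (-Z) (gaussianReal 0 v) P := by
    have := gaussianReal_neg hZ
    rwa [neg_zero] at this
  calc P.real {ω | a < |Z ω|} ≤ _ := measureReal_mono hsub
    _ ≤ _ := measureReal_union_le _ _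
    _ ≤ 8 * v ^ 2 / a ^ 4 + 8 * v ^ 2 / a ^ 4 := add_le_add (tail hZ) (tail hneg)
    _ = _ := by ring

/-- The probability that a Brownian motion is not tame in a given time slot of length `δ` is of
order `δ ^ 2`. -/
lemma measureReal_not_isTame_le {Ω : Type*} [MeasurableSpace Ω] {P : Measure Ω}
    [IsProbabilityMeasure P] {B : ℝ≥0 → Ω → ℝ} (hB : IsPreBrownianReal B P) {r : ℝ} (hr : 0 < r)
    {δ : ℝ≥0} (hδ : 0 < δ) (m : ℕ) :
    P.real {ω | ¬ IsTame r m fun n j ↦ B (dyadicTime δ n j) ω} ≤ 20 ^ 6 / r ^ 4 * δ ^ 2 := by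
  have hinc (n j : ℕ) : P {ω | stepBound r n <
        |B (dyadicTime δ (n + 1) (j + 1)) ω - B (dyadicTime δ (n + 1) j) ω|} ≤
      ENNReal.ofReal (16 * (δ / 2 ^ (n + 1)) ^ 2 / stepBound r n ^ 4) := by
    have hv : nndist (dyadicTime δ (n + 1) (j + 1)).1 (dyadicTime δ (n + 1) j).1 =
        δ / 2 ^ (n + 1) := by
      ext
      rw [coe_nndist, Real.dist_eq]
      change |(dyadicTime δ (n + 1) (j + 1) : ℝ) - dyadicTime δ (n + 1) j| = _
      have : (dyadicTime δ (n + 1) (j + 1) : ℝ) - dyadicTime δ (n + 1) j = δ / 2 ^ (n + 1) := by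
        simp only [dyadicTime]
        push_cast
        ring
      rw [this, abs_of_nonneg (by positivity)]
      push_cast
      rfl
    have hl := hB.hasLaw_sub (dyadicTime δ (n + 1) (j + 1)) (dyadicTime δ (n + 1) j)
    rw [hv] at hl
    rw [← ofReal_measureReal]
    refine ENNReal.ofReal_le_ofReal ?_
    have := measureReal_lt_abs_le_of_hasLaw_gaussianReal (by positivity) hl
      (a := stepBound r n) (by unfold stepBound; positivity)
    simpa using this
  -- the bounds of level `n + 1` add up to a geometric sequence
  let q : ℝ := 5000 / 6561
  have hq : HasSum (fun n ↦ 8 * 20 ^ 4 / r ^ 4 * δ ^ 2 * q ^ n)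
      (8 * 20 ^ 4 / r ^ 4 * δ ^ 2 * (1 - q)⁻¹) :=
    (hasSum_geometric_of_lt_one (by norm_num [q]) (by norm_num [q])).mul_left _
  have hlevel (n : ℕ) : P {ω | ∃ j ∈ Finset.Ico (m * 2 ^ (n + 1)) ((m + 1) * 2 ^ (n + 1)),
        stepBound r n <
          |B (dyadicTime δ (n + 1) (j + 1)) ω - B (dyadicTime δ (n + 1) j) ω|} ≤
      ENNReal.ofReal (8 * 20 ^ 4 / r ^ 4 * δ ^ 2 * q ^ n) := by
    have hset : {ω | ∃ j ∈ Finset.Ico (m * 2 ^ (n + 1)) ((m + 1) * 2 ^ (n + 1)),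
        stepBound r n <
          |B (dyadicTime δ (n + 1) (j + 1)) ω - B (dyadicTime δ (n + 1) j) ω|} =
        ⋃ j ∈ Finset.Ico (m * 2 ^ (n + 1)) ((m + 1) * 2 ^ (n + 1)), {ω | stepBound r n <
          |B (dyadicTime δ (n + 1) (j + 1)) ω - B (dyadicTime δ (n + 1) j) ω|} := by
      ext ω; simp
    rw [hset]
    refine (measure_biUnion_finset_le _ _).trans ((Finset.sum_le_sum fun j _ ↦ hinc n j).trans ?_)
    rw [Finset.sum_const, Nat.card_Ico, add_mul, one_mul, Nat.add_sub_cancel_left,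
      ← ENNReal.ofReal_nsmul]
    refine ENNReal.ofReal_le_ofReal (le_of_eq ?_)
    have h9 : ((9 / 10 : ℝ) ^ n) ^ 4 = (6561 / 10000) ^ n := by
      rw [← pow_mul, mul_comm, pow_mul]; norm_num
    have hqn : q ^ n * (2 ^ n * (6561 / 10000) ^ n) = 1 := by
      rw [← mul_pow, ← mul_pow]; norm_num [q]
    simp only [stepBound, nsmul_eq_mul]
    rw [mul_pow (r / 20), h9, pow_succ]
    push_cast
    field_simp
    linear_combination (-32 * 2 ^ n) * hqn
  have hset : {ω | ¬ IsTame r m fun n j ↦ B (dyadicTime δ n j) ω} =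
      ⋃ n, {ω | ∃ j ∈ Finset.Ico (m * 2 ^ (n + 1)) ((m + 1) * 2 ^ (n + 1)), stepBound r n <
          |B (dyadicTime δ (n + 1) (j + 1)) ω - B (dyadicTime δ (n + 1) j) ω|} := by
    ext ω; simp [IsTame, and_assoc]
  rw [hset]
  refine ENNReal.toReal_le_of_le_ofReal (by positivity) ?_
  refine (measure_iUnion_le _).trans ((ENNReal.tsum_le_tsum hlevel).trans ?_)
  rw [← ENNReal.ofReal_tsum_of_nonneg (fun n ↦ by positivity) hq.summable, hq.tsum_eq]
  refine ENNReal.ofReal_le_ofReal ?_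
  have h1 : (8 * 20 ^ 4 : ℝ) * (1 - q)⁻¹ ≤ 20 ^ 6 := by norm_num [q]
  calc 8 * 20 ^ 4 / r ^ 4 * (δ : ℝ) ^ 2 * (1 - q)⁻¹
      = 8 * 20 ^ 4 * (1 - q)⁻¹ * (δ ^ 2 / r ^ 4) := by ring
    _ ≤ 20 ^ 6 * (δ ^ 2 / r ^ 4) := by gcongr
    _ = _ := by ring

/-! ### Independent trials attached to independent positions -/

section Independence

variable {Ω E : Type*} [MeasurableSpace Ω] [MeasurableSpace E] {P : Measure Ω}
  [IsProbabilityMeasure P] {Y : ℕ → Ω → E}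

/-- Conditioning on the positions: a bound on the probability of avoiding `H` which holds for all
fixed positions in `G` holds on the event that the random positions are in `G`. -/
lemma measure_mem_and_forall_notMem_le {X : ℕ → Ω → ℝ} (hX : ∀ i, Measurable (X i))
    (hY : ∀ i, AEMeasurable (Y i) P)
    (hXY : IndepFun (fun ω i ↦ X i ω) (fun ω i ↦ Y i ω) P) {G : Set (ℕ → ℝ)}
    (hG : MeasurableSet G) {H : Set (ℝ × E)} (hH : MeasurableSet H) {η : ℝ≥0∞}
    (hη : ∀ x ∈ G, P {ω | ∀ i, (x i, Y i ω) ∉ H} ≤ η) :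
    P {ω | (fun i ↦ X i ω) ∈ G ∧ ∀ i, (X i ω, Y i ω) ∉ H} ≤
      η * P {ω | (fun i ↦ X i ω) ∈ G} := by
  have hX' : Measurable fun ω i ↦ X i ω := measurable_pi_lambda _ hX
  have hY' : AEMeasurable (fun ω i ↦ Y i ω) P := aemeasurable_pi_lambda _ hY
  have hlaw := hXY.map_prod_eq_prod_map_map hX'.aemeasurable hY'
  let S : Set ((ℕ → ℝ) × (ℕ → E)) := {p | p.1 ∈ G ∧ ∀ i, (p.1 i, p.2 i) ∉ H}
  have hS : MeasurableSet S := by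
    have : S = Prod.fst ⁻¹' G ∩
        ⋂ i, (fun p : (ℕ → ℝ) × (ℕ → E) ↦ (p.1 i, p.2 i)) ⁻¹' Hᶜ := by
      ext p; simp [S]
    rw [this]
    exact (measurable_fst hG).inter (.iInter fun i ↦ (by fun_prop : Measurable _) hH.compl)
  calc P {ω | (fun i ↦ X i ω) ∈ G ∧ ∀ i, (X i ω, Y i ω) ∉ H}
      = P.map (fun ω ↦ ((fun i ↦ X i ω), fun i ↦ Y i ω)) S :=
        (Measure.map_apply_of_aemeasurable (hX'.aemeasurable.prodMk hY') hS).symm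
    _ = ∫⁻ x, P.map (fun ω i ↦ Y i ω) (Prod.mk x ⁻¹' S) ∂P.map (fun ω i ↦ X i ω) := by
        rw [hlaw, Measure.prod_apply hS]
    _ ≤ ∫⁻ x, G.indicator (fun _ ↦ η) x ∂P.map (fun ω i ↦ X i ω) := by
        refine lintegral_mono fun x ↦ ?_
        by_cases hx : x ∈ G
        · rw [Set.indicator_of_mem hx,
            Measure.map_apply_of_aemeasurable hY' (measurable_prodMk_left hS)]
          refine (measure_mono fun ω hω ↦ ?_).trans (hη x hx)
          exact hω.2
        · have : Prod.mk x ⁻¹' S = ∅ := by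
            ext y; simp [S, hx]
          simp [this]
    _ = η * P {ω | (fun i ↦ X i ω) ∈ G} := by
        rw [lintegral_indicator_const hG, Measure.map_apply hX' hG]
        rfl

/-- If `k` of the independent trials have success probability at least `q j`, for each `j`, then
the probability that no trial succeeds is at most `exp (-k ∑ j, q j)`. -/
lemma measureReal_forall_notMem_le (hind : iIndepFun Y P)
    {A : ℕ → Set E} (hA : ∀ i, MeasurableSet (A i)) (hY : ∀ i, AEMeasurable (Y i) P) {J : Type*}
    [Fintype J] {I : J → Finset ℕ} (hI : Pairwise (Function.onFun Disjoint I)) {k : ℕ}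
    (hk : ∀ j, (I j).card = k) {q : J → ℝ} (hq : ∀ j, ∀ i ∈ I j, q j ≤ P.real (Y i ⁻¹' A i)) :
    P.real {ω | ∀ i, Y i ω ∉ A i} ≤ Real.exp (-(k * ∑ j, q j)) := by
  classical
  let U : Finset ℕ := Finset.univ.biUnion I
  have hmul : P.real (⋂ i ∈ U, Y i ⁻¹' (A i)ᶜ) = ∏ i ∈ U, P.real (Y i ⁻¹' (A i)ᶜ) := by
    simp only [Measure.real, ← ENNReal.toReal_prod]
    rw [hind.measure_inter_preimage_eq_mul U fun i _ ↦ (hA i).compl]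
  have hfail (j : J) (i : ℕ) (hi : i ∈ I j) : P.real (Y i ⁻¹' (A i)ᶜ) ≤ Real.exp (-q j) := by
    rw [Set.preimage_compl, probReal_compl_eq_one_sub₀ ((hY i).nullMeasurable (hA i))]
    linarith [hq j i hi, Real.one_sub_le_exp_neg (q j)]
  calc P.real {ω | ∀ i, Y i ω ∉ A i} ≤ P.real (⋂ i ∈ U, Y i ⁻¹' (A i)ᶜ) := by
        refine measureReal_mono fun ω hω ↦ ?_
        simpa using fun i _ ↦ hω i
    _ = ∏ j, ∏ i ∈ I j, P.real (Y i ⁻¹' (A i)ᶜ) := by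
        rw [hmul, Finset.prod_biUnion fun i _ j _ hij ↦ hI hij]
    _ ≤ ∏ j, Real.exp (-q j) ^ k := by
        refine Finset.prod_le_prod (fun j _ ↦ Finset.prod_nonneg fun i _ ↦ measureReal_nonneg)
          fun j _ ↦ ?_
        refine (Finset.prod_le_prod (fun i _ ↦ measureReal_nonneg) (hfail j)).trans_eq ?_
        rw [Finset.prod_const, hk j]
    _ = Real.exp (-(k * ∑ j, q j)) := by
        rw [Finset.prod_pow, ← Real.exp_sum, ← Real.exp_nat_mul, Finset.sum_neg_distrib, mul_neg]

end Independence

/-! ### Crowding the cells -/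

/-- The `j`-th of `2 * N` consecutive cells of length `ℓ`, which together cover `[-N ℓ, N ℓ)`. -/
def cell (ℓ : ℝ) (N : ℕ) (j : Fin (2 * N)) : Set ℝ :=
  Set.Ico (((j : ℕ) - N : ℝ) * ℓ) (((j : ℕ) - N + 1 : ℝ) * ℓ)

/-- The configurations with at least `k` points in each cell. -/
def crowded (ℓ : ℝ) (N k : ℕ) : Set (ℕ → ℝ) :=
  {x | ∀ j, (k : ℕ∞) ≤ {i | x i ∈ cell ℓ N j}.encard}

lemma measurableSet_cell (ℓ : ℝ) (N : ℕ) (j : Fin (2 * N)) : MeasurableSet (cell ℓ N j) :=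
  measurableSet_Ico

lemma mem_cell_iff {ℓ : ℝ} (hℓ : 0 < ℓ) {N : ℕ} {j : Fin (2 * N)} {x : ℝ} :
    x ∈ cell ℓ N j ↔ ⌊x / ℓ⌋ = (j : ℤ) - N := by
  rw [cell, Set.mem_Ico, Int.floor_eq_iff, le_div_iff₀ hℓ, div_lt_iff₀ hℓ]
  push_cast
  rfl

lemma pairwise_disjoint_cell {ℓ : ℝ} (hℓ : 0 < ℓ) (N : ℕ) :
    Pairwise (Function.onFun Disjoint (cell ℓ N)) := by
  intro i j hij
  refine Set.disjoint_left.2 fun x hi hj ↦ hij ?_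
  rw [mem_cell_iff hℓ] at hi hj
  ext
  omega

lemma volume_real_cell {ℓ : ℝ} (hℓ : 0 < ℓ) (N : ℕ) (j : Fin (2 * N)) :
    volume.real (cell ℓ N j) = ℓ := by
  rw [cell, Real.volume_real_Ico_of_le (by nlinarith)]
  ring

lemma natCast_le_encard_iff {s : Set ℕ} {k : ℕ} :
    (k : ℕ∞) ≤ s.encard ↔ ∃ I : Finset ℕ, I.card = k ∧ ↑I ⊆ s := by
  constructor
  · intro h
    obtain ⟨t, hts, ht⟩ := Set.exists_subset_encard_eq h
    have hfin : t.Finite := Set.finite_of_encard_eq_coe ht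
    refine ⟨hfin.toFinset, ?_, by simpa using hts⟩
    rw [hfin.encard_eq_coe_toFinset_card] at ht
    exact_mod_cast ht
  · rintro ⟨I, rfl, hI⟩
    simpa using Set.encard_le_encard hI

lemma measurableSet_crowded (ℓ : ℝ) (N k : ℕ) : MeasurableSet (crowded ℓ N k) := by
  have : crowded ℓ N k = ⋂ j, ⋃ (I : Finset ℕ) (_ : I.card = k),
      ⋂ i ∈ I, (fun x : ℕ → ℝ ↦ x i) ⁻¹' cell ℓ N j := by
    ext x
    simp only [crowded, Set.mem_ofPred_eq, natCast_le_encard_iff, Set.mem_iInter, Set.mem_iUnion,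
      Set.mem_preimage, exists_prop]
    rfl
  rw [this]
  refine .iInter fun j ↦ .iUnion fun I ↦ .iUnion fun _ ↦ .biInter I.countable_toSet fun i _ ↦ ?_
  exact measurable_pi_apply i (measurableSet_cell ℓ N j)

lemma le_measureReal_natCast_le_nodeCount {Ω : Type*} [MeasurableSpace Ω] {P : Measure Ω}
    [IsProbabilityMeasure P] {lam : ℝ} {X : ℕ → Ω → ℝ} (h : IsPoissonPointProcess lam X P)
    {A : Set ℝ} (hA : MeasurableSet A) (hA' : volume A ≠ ∞) (hlam : 0 < lam) (k : ℕ) :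
    Real.exp (-(lam * volume.real A)) * (lam * volume.real A) ^ k / k.factorial ≤
      P.real {ω | (k : ℕ∞) ≤ nodeCount X A ω} := by
  have hlaw := h.hasLaw_nodeCount A hA hA'
  have h1 : P.real {ω | (k : ℕ∞) ≤ nodeCount X A ω} =
      (poissonMeasure (lam * volume.real A).toNNReal).real {n | k ≤ n} := by
    rw [Measure.real, hlaw.measure_eq (p := fun n ↦ (k : ℕ∞) ≤ n) (.of_discrete),
      Measure.map_apply (by fun_prop) (.of_discrete)]
    simp [Measure.real]
  have h2 : (poissonMeasure (lam * volume.real A).toNNReal).real {k} ≤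
      (poissonMeasure (lam * volume.real A).toNNReal).real {n | k ≤ n} :=
    measureReal_mono (by simp)
  rw [poissonMeasure_real_singleton, Real.coe_toNNReal _ (by positivity)] at h2
  exact h2.trans_eq h1.symm

/-- The probability of crowding `2 * N` disjoint cells, from one Poisson atom in each of them. -/
lemma le_measureReal_crowded {Ω : Type*} [MeasurableSpace Ω] {P : Measure Ω}
    [IsProbabilityMeasure P] {lam : ℝ} {X : ℕ → Ω → ℝ} (h : IsPoissonPointProcess lam X P)
    (hlam : 0 < lam) {ℓ : ℝ} (hℓ : 0 < ℓ) (N k : ℕ) :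
    (Real.exp (-(lam * ℓ)) * (lam * ℓ) ^ k / k.factorial) ^ (2 * N) ≤
      P.real {ω | (fun i ↦ X i ω) ∈ crowded ℓ N k} := by
  have hind := h.iIndepFun_nodeCount (2 * N) (cell ℓ N) (measurableSet_cell ℓ N)
    (pairwise_disjoint_cell hℓ N)
  have hset : {ω | (fun i ↦ X i ω) ∈ crowded ℓ N k} =
      ⋂ j ∈ Finset.univ, nodeCount X (cell ℓ N j) ⁻¹' Set.Ici (k : ℕ∞) := by
    ext ω
    simp [crowded, nodeCount]
  rw [hset, Measure.real, hind.measure_inter_preimage_eq_mul _ fun j _ ↦ .of_discrete,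
    ENNReal.toReal_prod]
  calc _ = ∏ j : Fin (2 * N), Real.exp (-(lam * ℓ)) * (lam * ℓ) ^ k / k.factorial := by
        rw [Finset.prod_const, Finset.card_univ, Fintype.card_fin]
    _ ≤ _ := by
      refine Finset.prod_le_prod (fun j _ ↦ by positivity) fun j _ ↦ ?_
      have := le_measureReal_natCast_le_nodeCount h (measurableSet_cell ℓ N j)
        (by simp [cell]) hlam k
      rw [volume_real_cell hℓ] at this
      exact this

/-! ### A crowded configuration is rarely isolated in a time slot -/

/-- The cells centred around the origin carry most of the mass of a Gaussian law. -/
lemma three_quarters_le_sum_gaussianReal_cell {ℓ : ℝ} (hℓ : 0 < ℓ) {N : ℕ} (hN : 0 < N) {v : ℝ≥0}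
    (hv : 4 * v ≤ (N * ℓ) ^ 2) :
    3 / 4 ≤ ∑ j, (gaussianReal 0 v).real (Neg.neg ⁻¹' cell ℓ N j) := by
  have hpos : 0 < N * ℓ := by positivity
  have hdisj : Pairwise (Function.onFun Disjoint fun j ↦ Neg.neg ⁻¹' cell ℓ N j) :=
    fun i j hij ↦ (pairwise_disjoint_cell hℓ N hij).preimage _
  rw [← measureReal_iUnion_fintype hdisj fun j ↦ measurable_neg (measurableSet_cell ℓ N j)]
  have hcheb : (gaussianReal 0 v).real {x | N * ℓ ≤ |x|} ≤ 1 / 4 := by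
    have h := meas_ge_le_variance_div_sq (memLp_id_gaussianReal (μ := 0) (v := v) 2) hpos
    simp only [id_eq, integral_id_gaussianReal, sub_zero, variance_id_gaussianReal] at h
    refine ENNReal.toReal_le_of_le_ofReal (by norm_num) (h.trans (ENNReal.ofReal_le_ofReal ?_))
    rw [div_le_iff₀ (by positivity)]
    linarith
  have hsub : {x : ℝ | N * ℓ ≤ |x|}ᶜ ⊆ ⋃ j, Neg.neg ⁻¹' cell ℓ N j := by
    intro x hx
    have hx' : |-x| < N * ℓ := by
      rw [abs_neg]
      exact not_le.1 hx
    obtain ⟨h1, h2⟩ := abs_lt.1 hx'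
    have h3 : -(N : ℤ) ≤ ⌊-x / ℓ⌋ := by
      rw [Int.le_floor, le_div_iff₀ hℓ]
      push_cast
      linarith
    have h4 : ⌊-x / ℓ⌋ < N := by
      rw [Int.floor_lt, div_lt_iff₀ hℓ]
      exact_mod_cast h2
    refine Set.mem_iUnion.2 ⟨⟨(⌊-x / ℓ⌋ + N).toNat, by omega⟩, ?_⟩
    rw [Set.mem_preimage, mem_cell_iff hℓ]
    simp only
    omega
  have hms : MeasurableSet {x : ℝ | N * ℓ ≤ |x|} := measurableSet_le (by fun_prop) (by fun_prop)
  have := measureReal_mono (μ := gaussianReal 0 v) hsub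
  rw [probReal_compl_eq_one_sub hms] at this
  linarith

/-- The pairs of an initial position and a displacement (sampled at dyadic times) which are within
distance `r / 2` of the origin at the start of slot `m` and tame in this slot. -/
def covering (r : ℝ) (m : ℕ) : Set (ℝ × (ℕ → ℕ → ℝ)) :=
  {p | |p.1 + p.2 0 m| < r / 2 ∧ IsTame r m p.2}

lemma measurableSet_covering (r : ℝ) (m : ℕ) : MeasurableSet (covering r m) := by
  have h1 : MeasurableSet {p : ℝ × (ℕ → ℕ → ℝ) | |p.1 + p.2 0 m| < r / 2} :=
    measurableSet_lt (by fun_prop) measurable_const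
  exact h1.inter (measurable_snd (measurableSet_isTame r m))

/-- A node starting in a cell covers the origin during slot `m` if its displacement lies in the
reflected cell and is tame. -/
lemma gaussianReal_cell_sub_le {Ω : Type*} [MeasurableSpace Ω] {P : Measure Ω}
    [IsProbabilityMeasure P] {B : ℝ≥0 → Ω → ℝ} (hB : IsPreBrownianReal B P) {r : ℝ} (hr : 0 < r)
    {δ : ℝ≥0} (hδ : 0 < δ) (m : ℕ) {N : ℕ} {j : Fin (2 * N)} {x : ℝ} (hx : x ∈ cell (r / 2) N j) :
    (gaussianReal 0 (dyadicTime δ 0 m)).real (Neg.neg ⁻¹' cell (r / 2) N j) -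
        20 ^ 6 / r ^ 4 * δ ^ 2 ≤
      P.real {ω | (x, fun n j ↦ B (dyadicTime δ n j) ω) ∈ covering r m} := by
  have hlaw := hB.hasLaw_eval (dyadicTime δ 0 m)
  have hms : MeasurableSet (Neg.neg ⁻¹' cell (r / 2) N j) :=
    measurable_neg (measurableSet_cell _ N j)
  have h1 : (gaussianReal 0 (dyadicTime δ 0 m)).real (Neg.neg ⁻¹' cell (r / 2) N j) =
      P.real {ω | -B (dyadicTime δ 0 m) ω ∈ cell (r / 2) N j} := by
    rw [Measure.real, ← hlaw.map_eq, Measure.map_apply_of_aemeasurable hlaw.aemeasurable hms]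
    rfl
  have h2 : {ω | -B (dyadicTime δ 0 m) ω ∈ cell (r / 2) N j} ⊆
      {ω | (x, fun n j ↦ B (dyadicTime δ n j) ω) ∈ covering r m} ∪
        {ω | ¬ IsTame r m fun n j ↦ B (dyadicTime δ n j) ω} := by
    intro ω hω
    by_cases ht : IsTame r m fun n j ↦ B (dyadicTime δ n j) ω
    · refine Or.inl ⟨?_, ht⟩
      have hω' : -B (dyadicTime δ 0 m) ω ∈ cell (r / 2) N j := hω
      rw [cell, Set.mem_Ico] at hω' hx
      change |x + B (dyadicTime δ 0 m) ω| < r / 2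
      rw [abs_lt]
      constructor <;> linarith [hx.1, hx.2, hω'.1, hω'.2]
    · exact Or.inr ht
  have h3 := (measureReal_mono (μ := P) h2).trans (measureReal_union_le _ _)
  have h4 := measureReal_not_isTame_le hB hr hδ m
  linarith

section Isolation

variable {Ω : Type*} [MeasurableSpace Ω] {P : Measure Ω} [IsProbabilityMeasure P] {lam r : ℝ}
  {X : ℕ → Ω → ℝ} {ξ : ℕ → ℝ≥0 → Ω → ℝ}

/-- On the event of crowded cells, the conditional probability that no node covers the origin
throughout slot `m` is at most `exp (-k / 2)`. -/
lemma IsPoissonBrownianMotions.measure_crowded_and_not_covering_le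
    (h : IsPoissonBrownianMotions lam X ξ P) (hr : 0 < r) {N : ℕ} (hN : 0 < N) (k m : ℕ) {δ : ℝ≥0}
    (hδ : 0 < δ) (hv : 4 * (dyadicTime δ 0 m : ℝ) ≤ (N * (r / 2)) ^ 2)
    (hε : 2 * N * (20 ^ 6 / r ^ 4 * δ ^ 2) ≤ 1 / 4) :
    P {ω | (fun i ↦ X i ω) ∈ crowded (r / 2) N k ∧
        ∀ i, (X i ω, fun n j ↦ ξ i (dyadicTime δ n j) ω) ∉ covering r m} ≤
      ENNReal.ofReal (Real.exp (-(k / 2))) *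
        P {ω | (fun i ↦ X i ω) ∈ crowded (r / 2) N k} := by
  have hY (i : ℕ) : AEMeasurable (fun ω n j ↦ ξ i (dyadicTime δ n j) ω) P :=
    aemeasurable_pi_lambda _ fun n ↦ aemeasurable_pi_lambda _ fun j ↦ (h.brownian i).aemeasurable _
  -- restricting to the countably many dyadic times preserves all the independence assumptions
  have hind : iIndepFun (fun i ω n j ↦ ξ i (dyadicTime δ n j) ω) P :=
    h.iIndepFun_displacement.comp (fun _ y n j ↦ y (dyadicTime δ n j)) fun _ ↦ by fun_prop
  have hXY : IndepFun (fun ω i ↦ X i ω) (fun ω i n j ↦ ξ i (dyadicTime δ n j) ω) P :=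
    h.indepFun_position_displacement.comp (φ := id)
      (ψ := fun (y : ℕ → ℝ≥0 → ℝ) i n j ↦ y i (dyadicTime δ n j)) measurable_id (by fun_prop)
  refine measure_mem_and_forall_notMem_le h.poisson.measurable hY hXY
    (measurableSet_crowded _ N k) (measurableSet_covering r m) fun x hx ↦ ?_
  choose I hIk hI using fun j ↦ natCast_le_encard_iff.1 (hx j)
  have hdisj : Pairwise (Function.onFun Disjoint I) := by
    intro i j hij
    refine Finset.disjoint_left.2 fun a hai haj ↦ ?_
    exact Set.disjoint_left.1 (pairwise_disjoint_cell (half_pos hr) N hij) (hI i hai) (hI j haj)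
  have hmiss := measureReal_forall_notMem_le hind
    (A := fun i ↦ {y | (x i, y) ∈ covering r m})
    (fun i ↦ measurable_prodMk_left (measurableSet_covering r m)) hY hdisj hIk
    (q := fun j ↦ (gaussianReal 0 (dyadicTime δ 0 m)).real (Neg.neg ⁻¹' cell (r / 2) N j) -
        20 ^ 6 / r ^ 4 * δ ^ 2)
    fun j i hi ↦ gaussianReal_cell_sub_le (h.brownian i).toIsPreBrownianReal hr hδ m (hI j hi)
  have hsum : 1 / 2 ≤ ∑ j, ((gaussianReal 0 (dyadicTime δ 0 m)).real
      (Neg.neg ⁻¹' cell (r / 2) N j) - 20 ^ 6 / r ^ 4 * (δ : ℝ) ^ 2) := by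
    have := three_quarters_le_sum_gaussianReal_cell (half_pos hr) hN hv
    rw [Finset.sum_sub_distrib, Finset.sum_const, Finset.card_univ, Fintype.card_fin,
      nsmul_eq_mul]
    push_cast
    linarith
  rw [← ofReal_measureReal]
  refine ENNReal.ofReal_le_ofReal (hmiss.trans (Real.exp_le_exp.2 ?_))
  have hk : (0 : ℝ) ≤ k := k.cast_nonneg
  nlinarith

/-- A lower bound on the probability of no isolation during the first `M + 1` slots. -/
lemma IsPoissonBrownianMotions.le_measureReal_lt_isolationTime
    (h : IsPoissonBrownianMotions lam X ξ P) (hr : 0 < r) {N : ℕ} (hN : 0 < N) (k M : ℕ) {δ : ℝ≥0}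
    (hδ : 0 < δ) {t : ℝ} (ht : t < (M + 1) * δ) (hv : 4 * (M * δ : ℝ) ≤ (N * (r / 2)) ^ 2)
    (hε : 2 * N * (20 ^ 6 / r ^ 4 * δ ^ 2) ≤ 1 / 4) :
    (1 - (M + 1) * Real.exp (-(k / 2))) * P.real {ω | (fun i ↦ X i ω) ∈ crowded (r / 2) N k} ≤
      P.real {ω | ENNReal.ofReal t < isolationTime r X ξ ω} := by
  let G : Set Ω := {ω | (fun i ↦ X i ω) ∈ crowded (r / 2) N k}
  let bad : ℕ → Set Ω := fun m ↦ {ω | (fun i ↦ X i ω) ∈ crowded (r / 2) N k ∧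
    ∀ i, (X i ω, fun n j ↦ ξ i (dyadicTime δ n j) ω) ∉ covering r m}
  let C : Set Ω := {ω | ∀ i, Continuous (ξ i · ω)}
  have hC : P.real Cᶜ = 0 := by
    have : ∀ᵐ ω ∂P, ∀ i, Continuous (ξ i · ω) := ae_all_iff.2 fun i ↦ (h.brownian i).cont
    rw [Measure.real, show P Cᶜ = 0 from this, ENNReal.toReal_zero]
  have hbad (m : ℕ) (hm : m ∈ Finset.range (M + 1)) :
      P.real (bad m) ≤ Real.exp (-(k / 2)) * P.real G := by
    have hv' : 4 * (dyadicTime δ 0 m : ℝ) ≤ (N * (r / 2)) ^ 2 := by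
      refine le_trans ?_ hv
      have : (m : ℝ) ≤ M := by
        exact_mod_cast Nat.lt_succ_iff.1 (Finset.mem_range.1 hm)
      have h2 : (m : ℝ) * δ ≤ M * δ := by gcongr
      simp only [dyadicTime]
      push_cast
      linarith
    have := h.measure_crowded_and_not_covering_le hr hN k m hδ hv' hε
    have h3 := ENNReal.toReal_mono (by finiteness) this
    rwa [ENNReal.toReal_mul, ENNReal.toReal_ofReal (Real.exp_pos _).le] at h3
  have hsub : G ⊆ {ω | ENNReal.ofReal t < isolationTime r X ξ ω} ∪
      ((⋃ m ∈ Finset.range (M + 1), bad m) ∪ Cᶜ) := by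
    intro ω hG
    by_cases hωC : ω ∈ C
    swap
    · exact Or.inr (Or.inr hωC)
    by_cases hωb : ω ∈ ⋃ m ∈ Finset.range (M + 1), bad m
    · exact Or.inr (Or.inl hωb)
    left
    have hcov (m : ℕ) (hm : m < M + 1) :
        ∃ i, (X i ω, fun n j ↦ ξ i (dyadicTime δ n j) ω) ∈ covering r m := by
      by_contra! hno
      exact hωb (Set.mem_biUnion (Finset.mem_range.2 hm) ⟨hG, hno⟩)
    have hlate : (((M + 1 : ℕ) * δ : ℝ≥0) : ℝ≥0∞) ≤ isolationTime r X ξ ω := by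
      refine le_iInf₂ fun s hs ↦ ?_
      rw [ENNReal.coe_le_coe]
      by_contra! hlt
      obtain ⟨i, hi, htame⟩ := hcov ⌊s / δ⌋₊ (by
        rw [Nat.floor_lt zero_le, div_lt_iff₀ hδ]
        exact hlt)
      refine hs (Set.mem_iUnion.2 ⟨i, ?_⟩)
      have hosc := htame.abs_sub_le hr hδ (hωC i) rfl
      rw [Metric.mem_ball, dist_comm, Real.dist_eq, sub_zero]
      have hi' : |X i ω + ξ i (dyadicTime δ 0 ⌊s / δ⌋₊) ω| < r / 2 := hi
      rw [abs_lt] at hi' ⊢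
      rw [abs_le] at hosc
      constructor <;> linarith [hi'.1, hi'.2, hosc.1, hosc.2]
    refine lt_of_lt_of_le ?_ hlate
    rw [← ENNReal.ofReal_coe_nnreal]
    refine (ENNReal.ofReal_lt_ofReal_iff (by positivity)).2 ?_
    push_cast
    exact ht
  have h1 : P.real G ≤ P.real {ω | ENNReal.ofReal t < isolationTime r X ξ ω} +
      (P.real (⋃ m ∈ Finset.range (M + 1), bad m) + P.real Cᶜ) :=
    (measureReal_mono hsub).trans ((measureReal_union_le _ _).trans
      (add_le_add_right (measureReal_union_le _ _) _))
  have h2 : P.real (⋃ m ∈ Finset.range (M + 1), bad m) ≤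
      (M + 1) * (Real.exp (-(k / 2)) * P.real G) := by
    refine (measureReal_biUnion_finset_le _ _).trans ((Finset.sum_le_sum hbad).trans_eq ?_)
    simp
  change (1 - (M + 1) * Real.exp (-(k / 2))) * P.real G ≤ _
  linarith

end Isolation

/-! ### Measurability of the isolation event -/

section Measurability

variable {Ω : Type*} {r : ℝ} {X : ℕ → Ω → ℝ} {ξ : ℕ → ℝ≥0 → Ω → ℝ}

/-- With continuous paths, `t` precedes the isolation time exactly if the origin is covered at all
times up to `t`, because the set of isolated times is closed. -/
lemma lt_isolationTime_iff {ω : Ω} (hω : ∀ i, Continuous (ξ i · ω)) (t : ℝ≥0) :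
    (t : ℝ≥0∞) < isolationTime r X ξ ω ↔ ∀ s ≤ t, ∃ i, |X i ω + ξ i s ω| < r := by
  have hmem (s : ℝ≥0) : (0 : ℝ) ∈ ⋃ i, Metric.ball (X i ω + ξ i s ω) r ↔
      ∃ i, |X i ω + ξ i s ω| < r := by
    simp [Metric.mem_ball, dist_comm]
  simp only [isolationTime, hmem]
  constructor
  · intro h s hs
    by_contra hno
    exact absurd (h.trans_le (iInf₂_le s hno)) (by simpa using hs)
  · intro h
    have hopen : IsOpen {s | ∃ i, |X i ω + ξ i s ω| < r} := by
      have : {s | ∃ i, |X i ω + ξ i s ω| < r} = ⋃ i, {s | |X i ω + ξ i s ω| < r} := by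
        ext; simp
      rw [this]
      refine isOpen_iUnion fun i ↦ isOpen_lt ?_ continuous_const
      have := hω i
      fun_prop
    obtain ⟨u, hu, hsub⟩ := exists_Ico_subset_of_mem_nhds (hopen.mem_nhds (h t le_rfl))
      ⟨t + 1, lt_add_one t⟩
    refine lt_of_lt_of_le (ENNReal.coe_lt_coe.2 hu) (le_iInf₂ fun s hs ↦ ?_)
    rw [ENNReal.coe_le_coe]
    by_contra! hlt
    rcases le_total s t with hst | hst
    · exact hs (h s hst)
    · exact hs (hsub ⟨hst, hlt⟩)

/-- By compactness, covering up to time `t` is witnessed by finitely many nodes with a positive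
margin, and it can then be tested on a countable dense set of times, capped at `t`. -/
lemma forall_le_exists_iff {ω : Ω} (hω : ∀ i, Continuous (ξ i · ω)) (t : ℝ≥0) :
    (∀ s ≤ t, ∃ i, |X i ω + ξ i s ω| < r) ↔
      ∃ n l : ℕ, ∀ q : ℕ, ∃ i < n,
        |X i ω + ξ i (min (TopologicalSpace.denseSeq ℝ≥0 q) t) ω| ≤ r - 1 / (l + 1) := by
  constructor
  · intro h
    -- the sets of times covered by the first `n` nodes with margin `1 / (n + 1)` increase to all
    let U : ℕ → Set ℝ≥0 := fun n ↦ {s | ∃ i < n, |X i ω + ξ i s ω| < r - 1 / (n + 1)}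
    have hU (n : ℕ) : IsOpen (U n) := by
      have : U n = ⋃ i, ⋃ (_ : i < n), {s | |X i ω + ξ i s ω| < r - 1 / (n + 1)} := by
        ext; simp [U]
      rw [this]
      refine isOpen_iUnion fun i ↦ isOpen_iUnion fun _ ↦ isOpen_lt ?_ continuous_const
      have := hω i
      fun_prop
    have hmono : Monotone U := by
      rintro n n' hn s ⟨i, hi, his⟩
      refine ⟨i, hi.trans_le hn, his.trans_le ?_⟩
      gcongr
    have hcover : Set.Icc 0 t ⊆ ⋃ n, U n := by
      intro s hs
      obtain ⟨i, hi⟩ := h s hs.2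
      obtain ⟨n, hn⟩ := exists_nat_one_div_lt (sub_pos.2 hi)
      refine Set.mem_iUnion.2 ⟨max n (i + 1), i, by omega, ?_⟩
      have : 1 / (((max n (i + 1) : ℕ) : ℝ) + 1) ≤ 1 / (n + 1) := by
        gcongr
        exact le_max_left _ _
      linarith
    obtain ⟨n, hn⟩ := isCompact_Icc.elim_directed_cover U hU hcover hmono.directed_le
    refine ⟨n, n, fun q ↦ ?_⟩
    obtain ⟨i, hi, his⟩ := hn ⟨zero_le, min_le_right (TopologicalSpace.denseSeq ℝ≥0 q) t⟩
    exact ⟨i, hi, his.le⟩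
  · rintro ⟨n, l, h⟩ s hs
    have hclosed : IsClosed {s : ℝ≥0 | ∃ i < n, |X i ω + ξ i (min s t) ω| ≤ r - 1 / (l + 1)} := by
      have : {s : ℝ≥0 | ∃ i < n, |X i ω + ξ i (min s t) ω| ≤ r - 1 / (l + 1)} =
          ⋃ i ∈ Set.Iio n, {s : ℝ≥0 | |X i ω + ξ i (min s t) ω| ≤ r - 1 / (l + 1)} := by
        ext; simp
      rw [this]
      refine (Set.finite_Iio n).isClosed_biUnion fun i _ ↦ isClosed_le ?_ continuous_const
      have := hω i
      fun_prop
    obtain ⟨i, -, hi⟩ := (TopologicalSpace.denseRange_denseSeq ℝ≥0).induction_on (p := fun s : ℝ≥0 ↦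
      ∃ i < n, |X i ω + ξ i (min s t) ω| ≤ r - 1 / (l + 1)) s hclosed h
    rw [min_eq_left hs] at hi
    exact ⟨i, hi.trans_lt (sub_lt_self _ (by positivity))⟩

lemma IsPoissonBrownianMotions.nullMeasurableSet_lt_isolationTime
    [MeasurableSpace Ω] {P : Measure Ω} {lam : ℝ}
    (h : IsPoissonBrownianMotions lam X ξ P) (r : ℝ) (t : ℝ) :
    NullMeasurableSet {ω | ENNReal.ofReal t < isolationTime r X ξ ω} P := by
  have hC : ∀ᵐ ω ∂P, ∀ i, Continuous (ξ i · ω) := ae_all_iff.2 fun i ↦ (h.brownian i).cont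
  let S : Set Ω := ⋃ (n : ℕ) (l : ℕ), ⋂ q : ℕ, ⋃ (i : ℕ) (_ : i < n),
    {ω | |X i ω + ξ i (min (TopologicalSpace.denseSeq ℝ≥0 q) t.toNNReal) ω| ≤ r - 1 / (l + 1)}
  have hS : NullMeasurableSet S P := by
    refine .iUnion fun n ↦ .iUnion fun l ↦ .iInter fun q ↦ .iUnion fun i ↦ .iUnion fun _ ↦ ?_
    refine nullMeasurableSet_le ?_ aemeasurable_const
    have h1 := (h.poisson.measurable i).aemeasurable (μ := P)
    have h2 := (h.brownian i).aemeasurable (min (TopologicalSpace.denseSeq ℝ≥0 q) t.toNNReal)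
    exact (h1.add h2).abs
  refine hS.congr ?_
  filter_upwards [hC] with ω hω
  refine propext (Iff.symm ?_)
  change ((t.toNNReal : ℝ≥0∞) < isolationTime r X ξ ω) ↔ ω ∈ S
  rw [lt_isolationTime_iff hω, forall_le_exists_iff hω]
  simp [S]

end Measurability

/-! ### The cost of crowding -/

/-- An explicit lower bound for a Poisson probability, from `k! ≤ k ^ k`. -/
lemma exp_neg_le_poisson {μ : ℝ} (hμ : 0 < μ) {k : ℕ} (hk : 0 < k) :
    Real.exp (-(μ + k * |Real.log μ| + k * Real.log k)) ≤
      Real.exp (-μ) * μ ^ k / k.factorial := by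
  have hk' : (0 : ℝ) < k := by exact_mod_cast hk
  have h1 : Real.exp (-(k * |Real.log μ|)) ≤ μ ^ k := by
    rw [← Real.exp_log (pow_pos hμ k), Real.log_pow, Real.exp_le_exp]
    nlinarith [neg_abs_le (Real.log μ)]
  have h2 : Real.exp (-(k * Real.log k)) ≤ (k.factorial : ℝ)⁻¹ := by
    rw [← Real.log_pow, Real.exp_neg, Real.exp_log (by positivity)]
    refine inv_anti₀ (by positivity) ?_
    exact_mod_cast k.factorial_le_pow
  calc Real.exp (-(μ + k * |Real.log μ| + k * Real.log k))
      = Real.exp (-μ) * Real.exp (-(k * |Real.log μ|)) * Real.exp (-(k * Real.log k)) := by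
        rw [← Real.exp_add, ← Real.exp_add]
        ring_nf
    _ ≤ Real.exp (-μ) * μ ^ k * (k.factorial : ℝ)⁻¹ := by gcongr
    _ = _ := (div_eq_mul_inv _ _).symm

/-- With `⌈8 log t⌉` points in each of `2 ⌈4 √t / r⌉` cells, the total cost is of order
`√t log t log log t`. -/
lemma crowding_cost_le {μ r t : ℝ} (hμ : 0 < μ) (hr : 0 < r) (ht : Real.exp (Real.exp 1) ≤ t)
    {N k : ℕ} (hN : N = ⌈4 * √t / r⌉₊) (hk : k = ⌈8 * Real.log t⌉₊) :
    2 * N * (μ + k * |Real.log μ| + k * Real.log k) + Real.log 2 ≤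
      (2 * (4 / r + 1) * (μ + 9 * |Real.log μ| + 9 * (Real.log 9 + 1)) + 1) *
        √t * Real.log t * Real.log (Real.log t) := by
  have ht0 : 0 < t := (Real.exp_pos _).trans_le ht
  have h1e : (1 : ℝ) ≤ Real.exp 1 := Real.one_le_exp zero_le_one
  have hL' : Real.exp 1 ≤ Real.log t := (Real.le_log_iff_exp_le ht0).2 ht
  have hL : 1 ≤ Real.log t := h1e.trans hL'
  have hLL : 1 ≤ Real.log (Real.log t) := (Real.le_log_iff_exp_le (by linarith)).2 hL'
  have hs : 1 ≤ √t := by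
    rw [Real.one_le_sqrt]
    exact (Real.one_le_exp (Real.exp_pos 1).le).trans ht
  have hk9 : (k : ℝ) ≤ 9 * Real.log t := by
    rw [hk]
    have := Nat.ceil_lt_add_one (a := 8 * Real.log t) (by positivity)
    linarith
  have hk1 : (1 : ℝ) ≤ k := by
    rw [hk]
    linarith [Nat.le_ceil (8 * Real.log t)]
  have hNt : (N : ℝ) ≤ (4 / r + 1) * √t := by
    rw [hN]
    have := Nat.ceil_lt_add_one (a := 4 * √t / r) (by positivity)
    have h4 : 4 * √t / r = 4 / r * √t := by ring
    linarith
  generalize hx : Real.log t = x at *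
  generalize hy : Real.log x = y at *
  have hlogk : Real.log k ≤ (Real.log 9 + 1) * y := by
    have h9 : 0 ≤ Real.log 9 := Real.log_nonneg (by norm_num)
    calc Real.log k ≤ Real.log (9 * x) := Real.log_le_log (by linarith) hk9
      _ = Real.log 9 + y := by rw [Real.log_mul (by norm_num) (by linarith), hy]
      _ ≤ _ := by nlinarith
  have hxy : 1 ≤ x * y := one_le_mul_of_one_le_of_one_le hL hLL
  have hterm : μ + k * |Real.log μ| + k * Real.log k ≤
      (μ + 9 * |Real.log μ| + 9 * (Real.log 9 + 1)) * (x * y) := by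
    have e1 : μ ≤ μ * (x * y) := le_mul_of_one_le_right hμ.le hxy
    have e2 : k * |Real.log μ| ≤ 9 * |Real.log μ| * (x * y) := by
      have : (k : ℝ) ≤ 9 * (x * y) := hk9.trans (by nlinarith)
      calc k * |Real.log μ| ≤ 9 * (x * y) * |Real.log μ| := by gcongr
        _ = _ := by ring
    have e3 : k * Real.log k ≤ 9 * (Real.log 9 + 1) * (x * y) := by
      calc k * Real.log k ≤ 9 * x * ((Real.log 9 + 1) * y) :=
            mul_le_mul hk9 hlogk (Real.log_nonneg hk1) (by positivity)
        _ = _ := by ring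
    linarith
  have hnn : 0 ≤ μ + k * |Real.log μ| + k * Real.log k := by
    have := Real.log_nonneg hk1
    positivity
  have hprod : N * (μ + k * |Real.log μ| + k * Real.log k) ≤ (4 / r + 1) * √t *
      ((μ + 9 * |Real.log μ| + 9 * (Real.log 9 + 1)) * (x * y)) :=
    mul_le_mul hNt hterm hnn (by positivity)
  have h2 : Real.log 2 ≤ √t * (x * y) := by
    have := Real.log_two_lt_d9
    have := one_le_mul_of_one_le_of_one_le hs hxy
    linarith
  calc _ ≤ 2 * ((4 / r + 1) * √t *
      ((μ + 9 * |Real.log μ| + 9 * (Real.log 9 + 1)) * (x * y))) + √t * (x * y) := by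
        linarith
    _ = _ := by ring

theorem theorem2 (lam r : ℝ) (hlam : 0 < lam) (hr : 0 < r) :
    ∃ t₀ : ℝ, 0 < t₀ ∧ ∃ c : ℝ, 0 < c ∧
      ∀ (Ω : Type*) [MeasurableSpace Ω] (P : Measure Ω) [IsProbabilityMeasure P]
        (X : ℕ → Ω → ℝ) (ξ : ℕ → ℝ≥0 → Ω → ℝ), IsPoissonBrownianMotions lam X ξ P →
        ∀ t : ℝ, t₀ ≤ t →
          NullMeasurableSet {ω | ENNReal.ofReal t < isolationTime r X ξ ω} P ∧
          Real.exp (-c * √t * Real.log t * Real.log (Real.log t)) ≤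
            P.real {ω | ENNReal.ofReal t < isolationTime r X ξ ω} := by
  have hμ : 0 < lam * (r / 2) := by positivity
  have h9 : 0 < Real.log 9 := Real.log_pos (by norm_num)
  -- the second lower bound on `t` makes untame displacements negligible for slots of length `1 / t`
  refine ⟨max (Real.exp (Real.exp 1)) (8 * (4 / r + 1) * (20 ^ 6 / r ^ 4)),
    lt_max_of_lt_left (Real.exp_pos _),
    2 * (4 / r + 1) * (lam * (r / 2) + 9 * |Real.log (lam * (r / 2))| + 9 * (Real.log 9 + 1)) + 1,
    by positivity, fun Ω _ P _ X ξ h t ht ↦ ⟨h.nullMeasurableSet_lt_isolationTime r t, ?_⟩⟩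
  obtain ⟨hte, htr⟩ := max_le_iff.1 ht
  have ht2 : 2 ≤ t := by
    have h1 : (1 : ℝ) ≤ Real.exp 1 := Real.one_le_exp zero_le_one
    linarith [Real.add_one_le_exp (Real.exp 1)]
  have ht0 : 0 < t := by linarith
  have hlog : 0 < Real.log t := Real.log_pos (by linarith)
  obtain ⟨N, hN⟩ : ∃ N, N = ⌈4 * √t / r⌉₊ := ⟨_, rfl⟩
  obtain ⟨k, hk⟩ : ∃ k, k = ⌈8 * Real.log t⌉₊ := ⟨_, rfl⟩
  let M : ℕ := ⌊t ^ 2⌋₊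
  let δ : ℝ≥0 := t⁻¹.toNNReal
  have hδt : (δ : ℝ) = t⁻¹ := Real.coe_toNNReal _ (by positivity)
  have hδ : 0 < δ := Real.toNNReal_pos.2 (by positivity)
  have hN0 : 0 < N := by
    rw [hN]
    exact Nat.ceil_pos.2 (by positivity)
  have hk0 : 0 < k := by
    rw [hk]
    exact Nat.ceil_pos.2 (by positivity)
  have hM1 : (M : ℝ) ≤ t ^ 2 := Nat.floor_le (by positivity)
  have hM2 : t ^ 2 < M + 1 := Nat.lt_floor_add_one _
  have htM : t < (M + 1) * δ := by
    rw [hδt, ← div_eq_mul_inv, lt_div_iff₀ ht0]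
    linarith
  have hv : 4 * (M * δ : ℝ) ≤ (N * (r / 2)) ^ 2 := by
    have e1 : (M : ℝ) * δ ≤ t := by
      rw [hδt, ← div_eq_mul_inv, div_le_iff₀ ht0]
      linarith
    have e2 : 2 * √t ≤ N * (r / 2) := by
      have := Nat.le_ceil (4 * √t / r)
      rw [← hN, div_le_iff₀ hr] at this
      linarith
    calc 4 * (M * δ : ℝ) ≤ (2 * √t) ^ 2 := by
          rw [mul_pow, Real.sq_sqrt ht0.le]
          linarith
      _ ≤ _ := by gcongr
  have hε : 2 * N * (20 ^ 6 / r ^ 4 * (δ : ℝ) ^ 2) ≤ 1 / 4 := by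
    have hst : √t ≤ t := Real.sqrt_le_self_iff.2 (Or.inr (by linarith))
    have hs1 : 1 ≤ √t := Real.one_le_sqrt.2 (by linarith)
    have hNt : (N : ℝ) ≤ (4 / r + 1) * t := by
      have := Nat.ceil_lt_add_one (a := 4 * √t / r) (by positivity)
      rw [← hN] at this
      have h4 : 4 * √t / r ≤ 4 / r * t := by
        calc 4 * √t / r = 4 / r * √t := by ring
          _ ≤ 4 / r * t := by gcongr
      linarith
    calc 2 * N * (20 ^ 6 / r ^ 4 * (δ : ℝ) ^ 2)
        ≤ 2 * ((4 / r + 1) * t) * (20 ^ 6 / r ^ 4 * t⁻¹ ^ 2) := by rw [hδt]; gcongr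
      _ = (8 * (4 / r + 1) * (20 ^ 6 / r ^ 4)) / t * (1 / 4) := by field_simp; norm_num
      _ ≤ 1 * (1 / 4) := by
          gcongr
          exact (div_le_one ht0).2 htr
      _ = _ := one_mul _
  have hmiss : (M + 1) * Real.exp (-(k / 2 : ℝ)) ≤ 1 / 2 := by
    have e1 : Real.exp (-(k / 2 : ℝ)) ≤ (t ^ 4)⁻¹ := by
      rw [← Real.exp_log (show 0 < (t ^ 4)⁻¹ by positivity), Real.log_inv, Real.log_pow,
        Real.exp_le_exp]
      have := Nat.le_ceil (8 * Real.log t)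
      rw [← hk] at this
      push_cast
      linarith
    calc (M + 1) * Real.exp (-(k / 2 : ℝ)) ≤ (t ^ 2 + 1) * (t ^ 4)⁻¹ := by gcongr
      _ ≤ 1 / 2 := by
        rw [← div_eq_mul_inv, div_le_iff₀ (by positivity)]
        nlinarith [sq_nonneg (t ^ 2 - 4), mul_self_le_mul_self zero_le_two ht2]
  have hcrowd := le_measureReal_crowded h.poisson hlam (half_pos hr) N k
  have hmain := h.le_measureReal_lt_isolationTime hr hN0 k M hδ htM hv hε
  have hpow : Real.exp (-(2 * N * (lam * (r / 2) + k * |Real.log (lam * (r / 2))| +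
      k * Real.log k))) ≤ P.real {ω | (fun i ↦ X i ω) ∈ crowded (r / 2) N k} := by
    refine le_trans (le_of_eq ?_) ((pow_le_pow_left₀ (Real.exp_pos _).le
      (exp_neg_le_poisson hμ hk0) (2 * N)).trans hcrowd)
    rw [← Real.exp_nat_mul]
    push_cast
    ring_nf
  have hcost := crowding_cost_le hμ hr hte hN hk
  generalize hG : P.real {ω | (fun i ↦ X i ω) ∈ crowded (r / 2) N k} = g at *
  calc _ ≤ Real.exp (-(2 * N * (lam * (r / 2) + k * |Real.log (lam * (r / 2))| +
        k * Real.log k)) + -Real.log 2) := by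
        refine Real.exp_le_exp.2 ?_
        simp only [neg_mul]
        linarith
    _ = Real.exp (-(2 * N * (lam * (r / 2) + k * |Real.log (lam * (r / 2))| +
        k * Real.log k))) * (1 / 2) := by
        rw [Real.exp_add, Real.exp_neg (Real.log 2), Real.exp_log two_pos, one_div]
    _ ≤ g * (1 / 2) := by gcongr
    _ ≤ (1 - (M + 1) * Real.exp (-(k / 2 : ℝ))) * g := by
        have hg : 0 ≤ g := (Real.exp_pos _).le.trans hpow
        nlinarith
    _ ≤ _ := hmain
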